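/- **Theorem (minimax lower rate).** Let $r>0$, $\nu_*\ge 1$ and $c>0$. There is a constant $\tau>0$, depending only on $r$, $\nu_*$ and $c$, with the following property. Let $\mathcal X$ be a standard Borel space with a probability measure $\nu$, and let $\mathcal H$ be a separable real reproducing kernel Hilbert space of functions on $\mathcal X$ with measurable kernel $k$, $k(x,x)\le\kappa^2$ for all $x$, and feature map $\Phi(x)=k(\cdot,x)$. Let $B_\nu=\mathbb E_{X\sim\nu}[\Phi(X)\otimes\Phi(X)]$ be the covariance operator. Assume that $B_\nu$ has infinitely many positive eigenvalues $\mu_1\ge\mu_2\ge\dots>0$ (repeated according to multiplicity, $\mu_j\searrow 0$), and that $\mu_{2j}/\mu_j\ge 2^{-\nu_*}$ for all sufficiently large $j$. For $t,u>0$ put $$F(t)=\#\{j:\mu_j\ge t\},\qquad G(t)=\frac{t^{2r+1}}{F(t)}\ \ (=\infty\text{ if }F(t)=0),\qquad G^{-1}(u)=\max\{t>0: G(t)\le u\}.$$ For $\theta=(M,\sigma,R)\in(0,\infty)^3$ let $\mathcal M_\theta$ be the class of all distributions $P$ of $(X,Y)$ on $\mathcal X\times\mathbb R$ such that $X$ has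 distribution $\nu$; the regression function $f^*=f^*_P$, $f^*(x)=\mathbb E[Y\mid X=x]$, lies in $B_\nu^r B(\mathcal H,R)=\{B_\nu^r h:\|h\|_{\mathcal H}\le R\}$; and $\varepsilon=Y-f^*(X)$ satisfies, for every integer $m\ge2$, $$\mathbb E[\varepsilon^m\mid X]\le \tfrac12\, m!\,\sigma^2M^{m-2}\quad \nu\text{-a.s.}$$ Then for every $\theta=(M,\sigma,R)\in(0,\infty)^3$ with $M\ge c\,\sigma$, $$\liminf_{n\to\infty}\ \inf_{f_\bullet}\ \sup_{P\in\mathcal M_\theta} P^{\otimes n}\Big(\|f^*_P-f_{\mathbf z}\|_{\mathcal H}>\tau\, R\,G^{-1}\big(\tfrac{\sigma^2}{R^2n}\big)^{r}\Big)>0$$ and $$\liminf_{n\to\infty}\ \inf_{f_\bullet}\ \sup_{P\in\mathcal M_\theta} P^{\otimes n}\Big(\|f^*_P-f_{\mathbf z}\|_{L^2(\nu)}>\tau\, R\,G^{-1}\big(\tfrac{\sigma^2}{R^2n}\big)^{r+1/2}\Big)>0 .$$ Here the infimum is over all estimators $\mathbf z\mapsto f_{\mathbf z}$ based on a sample $\mathbf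 z\in(\mathcal X\times\mathbb R)^n$: measurable maps into $\mathcal H$ in the first case, and in the second case all real functions $f_{\mathbf z}(x)$ that are jointly measurable in $(\mathbf z,x)$ (in particular all measurable $\mathcal H$-valued estimators). -/

import Mathlib

open MeasureTheory ProbabilityTheory Filter Topology
open scoped ENNReal

noncomputable section

namespace KernelRegression

section Hilbert

variable {H : Type*} [NormedAddCommGroup H] [InnerProductSpace ℝ H] [CompleteSpace H]

/-- `μ 1 ≥ μ 2 ≥ … > 0` is the sequence of all positive eigenvalues of `B`, listed in
decreasing order and repeated according to multiplicity; there are infinitely many of them and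
they decrease to `0`. -/
structure IsPositiveEigenvalueSequence (B : H →L[ℝ] H) (μ : ℕ+ → ℝ) : Prop where
  antitone : Antitone μ
  pos : ∀ j, 0 < μ j
  tendsto_zero : Tendsto μ atTop (𝓝 0)
  multiplicity : ∀ t : ℝ, 0 < t →
    {j | μ j = t}.encard =
      Cardinal.toENat (Module.rank ℝ (Module.End.eigenspace (B : Module.End ℝ H) t))

/-- `f = B ^ r h` for a compact positive self-adjoint operator `B` and `r > 0`, through the
spectral decomposition of `B`: `f` is the sum over all `t > 0` of `t ^ r` times the orthogonal
projection of `h` onto the eigenspace of `B` for `t` (which is `{0}` unless `t` is an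
eigenvalue). -/
def IsPowerApply (B : H →L[ℝ] H) (r : ℝ) (h f : H) : Prop :=
  HasSum (fun t : Set.Ioi (0 : ℝ) =>
    (t : ℝ) ^ r • (Module.End.eigenspace (B : Module.End ℝ H) (t : ℝ)).starProjection h) f

/-- The source set `B ^ r B(H, R)`, where `B(H, R)` is the closed ball of radius `R`. -/
def sourceSet (B : H →L[ℝ] H) (r R : ℝ) : Set H :=
  {f | ∃ h : H, ‖h‖ ≤ R ∧ IsPowerApply B r h f}

end Hilbert

section Rates

/-- The counting function `F(t) = #{j : μ j ≥ t}`. -/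
def countF (μ : ℕ+ → ℝ) (t : ℝ) : ℕ∞ := {j | t ≤ μ j}.encard

/-- `G(t) = t ^ (2 r + 1) / F(t)` for `t > 0`, equal to `∞` where `F(t) = 0`. -/
def rateG (μ : ℕ+ → ℝ) (r t : ℝ) : ℝ≥0∞ :=
  ENNReal.ofReal (t ^ (2 * r + 1)) / (countF μ t : ℝ≥0∞)

/-- The generalized inverse `G⁻¹(u) = max {t > 0 : G(t) ≤ u}`, for `u > 0`. -/
def rateGInv (μ : ℕ+ → ℝ) (r u : ℝ) : ℝ :=
  sSup {t : ℝ | 0 < t ∧ rateG μ r t ≤ ENNReal.ofReal u}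

/-- The rate `R G⁻¹(σ² / (R² n)) ^ (r + s)`: `s = 0` for the norm of `H`, `s = 1 / 2` for the
norm of `L²(ν)`. -/
def rate (μ : ℕ+ → ℝ) (r s σ R : ℝ) (n : ℕ) : ℝ :=
  R * rateGInv μ r (σ ^ 2 / (R ^ 2 * n)) ^ (r + s)

end Rates

section Model

variable {X : Type*} [MeasurableSpace X]
variable (H : Type*) [NormedAddCommGroup H] [InnerProductSpace ℝ H] [CompleteSpace H]
  [RKHS ℝ H X ℝ]

/-- The scalar reproducing kernel `k(x, y)` of `H`. -/
def kern (x y : X) : ℝ := RKHS.kernel H x y 1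

/-- The canonical feature map `Φ(x) = k(·, x)`. -/
def feature (x : X) : H := RKHS.kerFun H x 1

/-- The (uncentered) covariance operator `B_ν = E[Φ(X) ⊗ Φ(X)]`. -/
def covOp (ν : Measure X) : H →L[ℝ] H :=
  ∫ x, InnerProductSpace.rankOne ℝ (feature H x) (feature H x) ∂ν

variable {H}

/-- `P` belongs to the model class with parameters `(M, σ, R)` and `f` is its regression
function: the `X`-marginal of `P` is `ν`, and the conditional distribution `Q x` of `Y` given
`X = x` has, for `ν`-almost every `x`, mean `f x` and deviations from it that satisfy the
Bernstein moment condition, where `f` satisfies the source condition. (Elements of the source set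
that agree `ν`-almost everywhere are equal, so `P` determines `f`.) -/
structure InModel (ν : Measure X) (r M σ R : ℝ) (P : Measure (X × ℝ)) (f : H) : Prop where
  source : f ∈ sourceSet (covOp H ν) r R
  cond : ∃ Q : Kernel X ℝ, IsMarkovKernel Q ∧ P = ν ⊗ₘ Q ∧ ∀ᵐ x ∂ν,
    (Integrable (fun y : ℝ => y) (Q x) ∧ ∫ y, y ∂(Q x) = f x) ∧
    ∀ m : ℕ, 2 ≤ m → Integrable (fun y : ℝ => (y - f x) ^ m) (Q x) ∧
      ∫ y, (y - f x) ^ m ∂(Q x) ≤ 1 / 2 * (m.factorial : ℝ) * σ ^ 2 * M ^ (m - 2)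

variable (H)

/-- `inf` over all estimators `f_•` with values in `H`, based on `n` observations, of the `sup`
over the model class of `P^n (‖f* - f_z‖_H > a)`. -/
def minimaxProbH [MeasurableSpace H] (ν : Measure X) (r M σ R : ℝ) (n : ℕ) (a : ℝ) : ℝ≥0∞ :=
  ⨅ (est : (Fin n → X × ℝ) → H) (_ : Measurable est),
    ⨆ (P : Measure (X × ℝ)) (f : H) (_ : InModel ν r M σ R P f),
      Measure.pi (fun _ : Fin n => P) {z | a < ‖f - est z‖}

/-- `inf` over all estimators `f_•` based on `n` observations of the `sup` over the model class of
`P^n (‖f* - f_z‖_{L²(ν)} > a)`. Here an estimator is any jointly measurable map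
`(z, x) ↦ f_z(x)`; this includes all the measurable `H`-valued estimators. -/
def minimaxProbL2 (ν : Measure X) (r M σ R : ℝ) (n : ℕ) (a : ℝ) : ℝ≥0∞ :=
  ⨅ (est : (Fin n → X × ℝ) → X → ℝ) (_ : Measurable (Function.uncurry est)),
    ⨆ (P : Measure (X × ℝ)) (f : H) (_ : InModel ν r M σ R P f),
      Measure.pi (fun _ : Fin n => P)
        {z | ENNReal.ofReal a < eLpNorm (fun x => f x - est z x) 2 ν}

end Model

end KernelRegression

end

/-! The lower bound comes from one hypercube of regression functions, used for both norms. Let `u =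
σ² / (R² n)`, `t = G⁻¹(u)` and `N = F(t)`, so that `t ^ (2r+1) ≤ u N` (`exists_rateGInv`). The
vertices are `∑ ± a e_j` over orthonormal eigenvectors with indices `N + 1, …, 2N`, where `N a² = c₁
R² t ^ (2r)`. Their eigenvalues lie in `[q t, t]`, with `q = 2 ^ (-ν_*)`: the upper bound because
the indices exceed `N`, the lower one by doubling. Hence the vertices lie in the source set once `c₁
≤ q ^ (2r)`.

The response takes the values `± L` with mean `f x`, where `L` is a small multiple of `σ`. Such
noise satisfies the Bernstein condition (`inModel_binaryKernel`). It requires `|f| ≤ L / 2`, which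
holds for large `n` because `t → 0`. Flipping one sign changes `f` by `2 a e_j`, and `e_j` has
squared `L²(ν)` norm `μ j ≤ t`. The `χ²`-divergence along an edge is thus at most `6 a² t / L²`,
which `t ^ (2r+1) ≤ u N` turns into at most `1 / n` for small `c₁`.

Assouad's lemma then gives a vertex at which, with probability at least `1 / 64`, a `1 / 64`
proportion of the decoded signs is wrong. By Bessel's inequality each wrong sign costs `a²` in
squared `H` norm and at least `a² q t` in squared `L²(ν)` norm. Summing gives the orders `R² t ^
(2r)` and `R² t ^ (2r+1)`. -/

namespace KernelRegression

/-! ### Assouad's lemma -/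

section Assouad

open Classical in
/-- **Assouad's lemma**, in probability: if measures indexed by the vertices of a hypercube are
pairwise hard to distinguish along edges, every measurable guess of the vertex is wrong in a fixed
proportion of the coordinates with a fixed probability, for some vertex. -/
theorem exists_le_measureReal_card_ne {Ω ι : Type*} [MeasurableSpace Ω] [Fintype ι] [Nonempty ι]
    (P : (ι → Bool) → Measure Ω) [∀ θ, IsProbabilityMeasure (P θ)] {δ : ℝ}
    (hP : ∀ θ i, ∀ A : Set Ω, MeasurableSet A →
      δ ≤ (P θ).real A + (P (Function.update θ i (!θ i))).real Aᶜ)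
    (T : Ω → ι → Bool) (hT : ∀ i, Measurable fun ω => T ω i) :
    ∃ θ, δ / 4 ≤ (P θ).real
      {ω | δ / 4 * Fintype.card ι ≤ (Finset.univ.filter fun i => T ω i ≠ θ i).card} := by
  set m : ℝ := (Fintype.card ι : ℝ) with hm
  have hm0 : 0 < m := by simp [hm, Fintype.card_pos]
  have hne (θ : ι → Bool) (i : ι) : MeasurableSet {ω | T ω i ≠ θ i} :=
    (hT i (measurableSet_singleton (θ i))).compl
  -- Pair each vertex with its neighbour across coordinate `i`: a right guess at one is a wrong
  -- guess at the other.
  have hcoord (i : ι) : δ / 2 * Fintype.card (ι → Bool) ≤ ∑ θ, (P θ).real {ω | T ω i ≠ θ i} := by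
    let flip : (ι → Bool) → (ι → Bool) := fun θ => Function.update θ i (!θ i)
    have hflip : Function.Involutive flip := fun θ => by simp [flip]
    have h1 : ∑ θ, (P (flip θ)).real {ω | T ω i ≠ flip θ i} =
        ∑ θ, (P θ).real {ω | T ω i ≠ θ i} :=
      Equiv.sum_comp hflip.toPerm fun θ => (P θ).real {ω | T ω i ≠ θ i}
    have h2 : ∑ _θ : ι → Bool, δ ≤
        ∑ θ, ((P θ).real {ω | T ω i ≠ θ i} + (P (flip θ)).real {ω | T ω i ≠ flip θ i}) := by
      refine Finset.sum_le_sum fun θ _ => ?_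
      have hcompl : {ω | T ω i ≠ flip θ i} = {ω | T ω i ≠ θ i}ᶜ := by
        ext ω
        simp only [flip, Function.update_self, Set.mem_ofPred_eq, Set.mem_compl_iff]
        cases T ω i <;> cases θ i <;> simp
      rw [hcompl]
      exact hP θ i _ (hne θ i)
    rw [Finset.sum_add_distrib, h1] at h2
    simp only [Finset.sum_const, Finset.card_univ, nsmul_eq_mul] at h2
    linarith
  obtain ⟨θ, hθ⟩ : ∃ θ, δ / 2 * m ≤ ∑ i, (P θ).real {ω | T ω i ≠ θ i} := by
    by_contra! h
    have h1 : ∑ θ, ∑ i, (P θ).real {ω | T ω i ≠ θ i} < ∑ _θ : ι → Bool, δ / 2 * m :=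
      Finset.sum_lt_sum_of_nonempty Finset.univ_nonempty fun θ _ => h θ
    rw [Finset.sum_comm] at h1
    have h2 := Finset.sum_le_sum fun i (_ : i ∈ Finset.univ) => hcoord i
    simp only [Finset.sum_const, Finset.card_univ, nsmul_eq_mul] at h1 h2
    rw [← hm] at h2
    linarith
  refine ⟨θ, ?_⟩
  set d : Ω → ℝ := fun ω => ((Finset.univ.filter fun i => T ω i ≠ θ i).card : ℝ) with hd
  have hdsum (ω : Ω) : d ω = ∑ i, ({ω | T ω i ≠ θ i}.indicator (fun _ => (1 : ℝ)) ω) := by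
    simp [hd, Finset.card_filter, Set.indicator_apply]
  have h_int (i : ι) : Integrable ({ω | T ω i ≠ θ i}.indicator (fun _ => (1 : ℝ))) (P θ) :=
    (integrable_const 1).indicator (hne θ i)
  have hdint : Integrable d (P θ) := by
    rw [funext hdsum]; exact integrable_finsetSum _ fun i _ => h_int i
  have hdE : ∫ ω, d ω ∂(P θ) = ∑ i, (P θ).real {ω | T ω i ≠ θ i} := by
    rw [funext hdsum, integral_finsetSum _ fun i _ => h_int i]
    exact Finset.sum_congr rfl fun i _ => by
      rw [integral_indicator_const _ (hne θ i)]; simp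
  have hdmeas : Measurable d := by
    rw [funext hdsum]
    exact Finset.measurable_sum _ fun i _ => measurable_const.indicator (hne θ i)
  set E : Set Ω := {ω | δ / 4 * m ≤ d ω}
  have hE : MeasurableSet E := measurableSet_le measurable_const hdmeas
  have hdm (ω : Ω) : d ω ≤ m := by
    simp only [hd, hm]; exact_mod_cast Finset.card_le_univ _
  have hδ : δ ≤ 2 := by
    have := hP θ (Classical.arbitrary ι) Set.univ MeasurableSet.univ
    have h2 : (P (Function.update θ (Classical.arbitrary ι) (!θ (Classical.arbitrary ι)))).real
      Set.univᶜ = 0 := by simp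
    rw [h2] at this
    have h3 : (P θ).real Set.univ = 1 := by simp
    linarith
  -- Reverse Markov inequality: since `d ≤ m`, a mean of at least `δ m / 2` forces `d ≥ δ m / 4`
  -- with probability at least `δ / 4`.
  have hle (ω : Ω) : d ω ≤ δ / 4 * m + E.indicator (fun _ => m - δ / 4 * m) ω := by
    by_cases h : ω ∈ E
    · simpa [h] using hdm ω
    · have h' := h
      simp only [E, Set.mem_ofPred_eq, not_le] at h'
      simpa [h] using h'.le
  have hI : ∫ ω, d ω ∂(P θ) ≤ δ / 4 * m + (P θ).real E * (m - δ / 4 * m) := by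
    have hind : Integrable (E.indicator fun _ => m - δ / 4 * m) (P θ) :=
      (integrable_const _).indicator hE
    refine (integral_mono hdint ((integrable_const (δ / 4 * m)).add hind) hle).trans_eq ?_
    rw [integral_add' (integrable_const _) hind, integral_indicator_const _ hE]
    simp
  rw [hdE] at hI
  have h5 : δ / 4 * m ≤ (P θ).real E * (m - δ / 4 * m) := by linarith
  have hE0 : 0 ≤ (P θ).real E := measureReal_nonneg
  by_cases hδ0 : δ ≤ 0
  · linarith
  · push Not at hδ0
    have h6 : (P θ).real E * (m - δ / 4 * m) ≤ (P θ).real E * m := by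
      gcongr
      nlinarith
    exact le_of_mul_le_mul_right (h5.trans h6) hm0

end Assouad

/-! ### Product likelihood ratios and the `χ²` bound -/

section LikelihoodRatio

theorem lintegral_pi_prod {ι E : Type*} [Fintype ι] [MeasurableSpace E] (P : Measure E)
    [IsProbabilityMeasure P] (g : ι → E → ℝ≥0∞) (hg : ∀ i, Measurable (g i)) :
    ∫⁻ z, ∏ i, g i (z i) ∂(Measure.pi fun _ : ι => P) = ∏ i, ∫⁻ e, g i e ∂P := by
  have hind : iIndepFun (fun i (z : ι → E) => g i (z i)) (Measure.pi fun _ : ι => P) :=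
    iIndepFun_pi fun i => (hg i).aemeasurable
  rw [lintegral_prod_eq_prod_lintegral_of_indepFun Finset.univ _ hind
    fun i => (hg i).comp (measurable_pi_apply i)]
  refine Finset.prod_congr rfl fun i _ => ?_
  exact (measurePreserving_eval (fun _ : ι => P) i).lintegral_comp (hg i)

theorem pi_withDensity {ι E : Type*} [Fintype ι] [MeasurableSpace E] (P : Measure E)
    [IsProbabilityMeasure P] (l : E → ℝ≥0∞) (hl : Measurable l)
    [IsProbabilityMeasure (P.withDensity l)] :
    Measure.pi (fun _ : ι => P.withDensity l) =
      (Measure.pi fun _ : ι => P).withDensity fun z => ∏ i, l (z i) := by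
  refine Measure.pi_eq fun s hs => ?_
  rw [withDensity_apply _ (MeasurableSet.univ_pi hs),
    ← lintegral_indicator (MeasurableSet.univ_pi hs)]
  have hprod : ∏ i, P.withDensity l (s i) = ∏ i, ∫⁻ e, (s i).indicator l e ∂P :=
    Finset.prod_congr rfl fun i _ => by rw [withDensity_apply l (hs i), lintegral_indicator (hs i)]
  rw [hprod, ← lintegral_pi_prod P _ fun i => hl.indicator (hs i)]
  refine lintegral_congr fun z => ?_
  by_cases hz : z ∈ Set.univ.pi s
  · rw [Set.indicator_of_mem hz]
    exact Finset.prod_congr rfl fun i _ => (Set.indicator_of_mem (hz i trivial) l).symm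
  · rw [Set.indicator_of_notMem hz]
    obtain ⟨i, hi⟩ : ∃ i, z i ∉ s i := by simpa using hz
    exact (Finset.prod_eq_zero (Finset.mem_univ i) (Set.indicator_of_notMem hi l)).symm

/-- Cauchy–Schwarz applied to `∫ L 1_A`. -/
theorem withDensity_apply_sq_le {Ω : Type*} [MeasurableSpace Ω] (P : Measure Ω)
    {L : Ω → ℝ≥0∞} (hL : Measurable L) {A : Set Ω} (hA : MeasurableSet A) :
    P.withDensity L A ^ 2 ≤ (∫⁻ ω, L ω ^ 2 ∂P) * P A := by
  have h := ENNReal.lintegral_mul_le_Lp_mul_Lq P Real.HolderConjugate.two_two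
    hL.aemeasurable ((measurable_const (a := (1 : ℝ≥0∞))).indicator hA).aemeasurable
  have h1 : ∫⁻ ω, (L * A.indicator fun _ => (1 : ℝ≥0∞)) ω ∂P = P.withDensity L A := by
    rw [withDensity_apply _ hA, ← lintegral_indicator hA]
    refine lintegral_congr fun ω => ?_
    by_cases hω : ω ∈ A <;> simp [hω]
  have h2 : ∫⁻ ω, (A.indicator (fun _ => (1 : ℝ≥0∞)) ω) ^ (2 : ℝ) ∂P = P A := by
    rw [← lintegral_indicator_one hA]
    refine lintegral_congr fun ω => ?_
    by_cases hω : ω ∈ A <;> simp [hω]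
  rw [h1, h2] at h
  simp_rw [ENNReal.rpow_two] at h
  calc P.withDensity L A ^ 2
      ≤ ((∫⁻ ω, L ω ^ 2 ∂P) ^ (1 / (2 : ℝ)) * P A ^ (1 / (2 : ℝ))) ^ 2 := by gcongr
    _ = _ := by
      rw [mul_pow, ← ENNReal.rpow_two, ← ENNReal.rpow_two, ← ENNReal.rpow_mul,
        ← ENNReal.rpow_mul]
      simp

theorem one_add_inv_pow_le_four (n : ℕ) (hn : n ≠ 0) :
    (1 + (n : ℝ≥0∞)⁻¹) ^ n ≤ 4 := by
  have hr : (1 + (n : ℝ)⁻¹) ^ n ≤ 4 := by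
    calc (1 + (n : ℝ)⁻¹) ^ n ≤ Real.exp ((n : ℝ)⁻¹) ^ n := by
          gcongr; rw [add_comm]; exact Real.add_one_le_exp _
      _ = Real.exp 1 := by
          rw [← Real.exp_nat_mul, mul_inv_cancel₀ (by exact_mod_cast hn)]
      _ ≤ 4 := by linarith [Real.exp_one_lt_d9]
  have h := ENNReal.ofReal_le_ofReal hr
  rw [ENNReal.ofReal_pow (by positivity), ENNReal.ofReal_add zero_le_one (by positivity),
    ENNReal.ofReal_inv_of_pos (by positivity)] at h
  simpa using h

/-- If the `χ²`-divergence of `Q = l P` from `P` is at most `1 / n`, then no test based on `n`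
observations separates `P` from `Q`. -/
theorem le_measureReal_add_of_lintegral_sq_le {E : Type*} [MeasurableSpace E] {n : ℕ} (hn : n ≠ 0)
    (P : Measure E) [IsProbabilityMeasure P] {l : E → ℝ≥0∞} (hl : Measurable l)
    [IsProbabilityMeasure (P.withDensity l)]
    (h : ∫⁻ e, l e ^ 2 ∂P ≤ 1 + (n : ℝ≥0∞)⁻¹) {A : Set (Fin n → E)} (hA : MeasurableSet A) :
    1 / 16 ≤ (Measure.pi fun _ : Fin n => P).real A +
      (Measure.pi fun _ : Fin n => P.withDensity l).real Aᶜ := by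
  have hsq : (Measure.pi fun _ : Fin n => P.withDensity l) A ^ 2 ≤
      4 * (Measure.pi fun _ : Fin n => P) A := by
    rw [pi_withDensity P l hl]
    refine (withDensity_apply_sq_le _ (by fun_prop) hA).trans ?_
    gcongr
    simp_rw [← Finset.prod_pow]
    rw [lintegral_pi_prod P (fun _ e => l e ^ 2) fun _ => hl.pow_const 2]
    simp only [Finset.prod_const, Finset.card_univ, Fintype.card_fin]
    exact (pow_le_pow_left₀ (by simp) h n).trans (one_add_inv_pow_le_four n hn)
  have hreal : (Measure.pi fun _ : Fin n => P.withDensity l).real A ^ 2 ≤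
      4 * (Measure.pi fun _ : Fin n => P).real A := by
    have := ENNReal.toReal_mono (by finiteness) hsq
    simpa [Measure.real] using this
  rw [probReal_compl_eq_one_sub hA]
  have h0 : 0 ≤ (Measure.pi fun _ : Fin n => P.withDensity l).real A := measureReal_nonneg
  have h1 : (Measure.pi fun _ : Fin n => P.withDensity l).real A ≤ 1 := measureReal_le_one
  -- With `x = Pⁿ(A)` and `y = Qⁿ(A)`, `x ≥ y² / 4` gives `x + 1 - y ≥ (1 - y / 2)² ≥ 1 / 4`.
  nlinarith

end LikelihoodRatio

/-! ### Two-valued responses -/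

section BinaryResponse

variable {X : Type*} [MeasurableSpace X]

/-- The kernel of a response with values `± L` that is `L` with probability `p x`. -/
noncomputable def binaryKernel (L : ℝ) (p : X → ℝ) (hp : Measurable p) : Kernel X ℝ where
  toFun x := ENNReal.ofReal (p x) • Measure.dirac L + ENNReal.ofReal (1 - p x) • Measure.dirac (-L)
  measurable' := by
    refine Measure.measurable_of_measurable_coe _ fun s hs => ?_
    simp only [Measure.coe_add, Measure.coe_smul, Pi.add_apply, Pi.smul_apply, smul_eq_mul]
    fun_prop

theorem binaryKernel_apply (L : ℝ) {p : X → ℝ} (hp : Measurable p) (x : X) :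
    binaryKernel L p hp x =
      ENNReal.ofReal (p x) • Measure.dirac L + ENNReal.ofReal (1 - p x) • Measure.dirac (-L) := rfl

theorem isMarkovKernel_binaryKernel (L : ℝ) {p : X → ℝ} (hp : Measurable p)
    (h0 : ∀ x, 0 ≤ p x) (h1 : ∀ x, p x ≤ 1) : IsMarkovKernel (binaryKernel L p hp) := by
  refine ⟨fun x => ⟨?_⟩⟩
  rw [binaryKernel_apply]
  simp only [Measure.coe_add, Measure.coe_smul, Pi.add_apply, Pi.smul_apply, smul_eq_mul,
    measure_univ, mul_one]
  rw [← ENNReal.ofReal_add (h0 x) (by linarith [h1 x])]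
  simp

theorem integrable_binaryKernel (L : ℝ) {p : X → ℝ} (hp : Measurable p) (g : ℝ → ℝ) (x : X) :
    Integrable g (binaryKernel L p hp x) := by
  rw [binaryKernel_apply]
  exact ((integrable_dirac (by simp)).smul_measure (by simp)).add_measure
    ((integrable_dirac (by simp)).smul_measure (by simp))

theorem integral_binaryKernel (L : ℝ) {p : X → ℝ} (hp : Measurable p)
    (h0 : ∀ x, 0 ≤ p x) (h1 : ∀ x, p x ≤ 1) (g : ℝ → ℝ) (x : X) :
    ∫ y, g y ∂(binaryKernel L p hp x) = p x * g L + (1 - p x) * g (-L) := by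
  rw [binaryKernel_apply, integral_add_measure, integral_smul_measure, integral_smul_measure,
    integral_dirac, integral_dirac, ENNReal.toReal_ofReal (h0 x),
    ENNReal.toReal_ofReal (by linarith [h1 x])]
  · simp
  · exact (integrable_dirac (by simp)).smul_measure (by simp)
  · exact (integrable_dirac (by simp)).smul_measure (by simp)

theorem lintegral_compProd_binaryKernel (ν : Measure X) [IsProbabilityMeasure ν] (L : ℝ)
    {p : X → ℝ} (hp : Measurable p) [IsMarkovKernel (binaryKernel L p hp)]
    {g : X × ℝ → ℝ≥0∞} (hg : Measurable g) :
    ∫⁻ z, g z ∂(ν ⊗ₘ binaryKernel L p hp) =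
      ∫⁻ x, ENNReal.ofReal (p x) * g (x, L) + ENNReal.ofReal (1 - p x) * g (x, -L) ∂ν := by
  rw [Measure.lintegral_compProd hg]
  simp [binaryKernel_apply]

/-- The likelihood ratio of two binary responses. -/
noncomputable def binaryRatio (L : ℝ) (p q : X → ℝ) (z : X × ℝ) : ℝ≥0∞ :=
  if z.2 = L then ENNReal.ofReal (q z.1 / p z.1)
  else ENNReal.ofReal ((1 - q z.1) / (1 - p z.1))

theorem measurable_binaryRatio (L : ℝ) {p q : X → ℝ} (hp : Measurable p) (hq : Measurable q) :
    Measurable (binaryRatio L p q) := by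
  refine Measurable.ite (measurable_snd (measurableSet_singleton L)) ?_ ?_ <;> fun_prop

theorem compProd_binaryKernel_eq_withDensity (ν : Measure X) [IsProbabilityMeasure ν] {L : ℝ}
    (hL : 0 < L) {p q : X → ℝ} (hp : Measurable p) (hq : Measurable q)
    [IsMarkovKernel (binaryKernel L p hp)] [IsMarkovKernel (binaryKernel L q hq)]
    (h0 : ∀ x, 0 < p x) (h1 : ∀ x, p x < 1) :
    ν ⊗ₘ binaryKernel L q hq = (ν ⊗ₘ binaryKernel L p hp).withDensity (binaryRatio L p q) := by
  -- The atoms must be distinct for `-L` to fall in the `else` branch of `binaryRatio`.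
  have hL' : -L ≠ L := by linarith
  have hr := measurable_binaryRatio L hp hq
  ext s hs
  rw [withDensity_apply _ hs, ← lintegral_indicator hs, ← lintegral_indicator_one hs,
    lintegral_compProd_binaryKernel ν L hq (measurable_one.indicator hs),
    lintegral_compProd_binaryKernel ν L hp (hr.indicator hs)]
  refine lintegral_congr fun x => ?_
  have hp0 := h0 x
  have hp1 : 0 < 1 - p x := by linarith [h1 x]
  congr 1
  · by_cases hx : (x, L) ∈ s
    · rw [Set.indicator_of_mem hx, Set.indicator_of_mem hx, binaryRatio, if_pos rfl,
        ← ENNReal.ofReal_mul hp0.le, mul_div_cancel₀ _ hp0.ne']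
      simp
    · simp [hx]
  · by_cases hx : (x, -L) ∈ s
    · rw [Set.indicator_of_mem hx, Set.indicator_of_mem hx, binaryRatio, if_neg hL',
        ← ENNReal.ofReal_mul hp1.le, mul_div_cancel₀ _ hp1.ne']
      simp
    · simp [hx]

/-- The conditional `χ²`-divergence is `(p - q)² / (p (1 - p))`, and `p (1 - p) ≥ 3 / 16 ≥ 1 / 6` on
`[1/4, 3/4]`. -/
theorem lintegral_binaryRatio_sq_le (ν : Measure X) [IsProbabilityMeasure ν] {L : ℝ}
    (hL : 0 < L) {p q : X → ℝ} (hp : Measurable p) (hq : Measurable q)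
    [IsMarkovKernel (binaryKernel L p hp)] (hp0 : ∀ x, 1 / 4 ≤ p x) (hp1 : ∀ x, p x ≤ 3 / 4)
    (hq0 : ∀ x, 0 ≤ q x) (hq1 : ∀ x, q x ≤ 1) :
    ∫⁻ z, binaryRatio L p q z ^ 2 ∂(ν ⊗ₘ binaryKernel L p hp) ≤
      1 + ∫⁻ x, ENNReal.ofReal (6 * (p x - q x) ^ 2) ∂ν := by
  have hL' : -L ≠ L := by linarith
  rw [lintegral_compProd_binaryKernel ν L hp ((measurable_binaryRatio L hp hq).pow_const 2)]
  have hone : (1 : ℝ≥0∞) = ∫⁻ _, 1 ∂ν := by simp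
  rw [hone, ← lintegral_add_left measurable_const]
  refine lintegral_mono fun x => ?_
  have ha : 0 < p x := by linarith [hp0 x]
  have hb : 0 < 1 - p x := by linarith [hp1 x]
  have hq0 := hq0 x
  have hq1 : 0 ≤ 1 - q x := by linarith [hq1 x]
  simp only [binaryRatio, if_neg hL', if_true]
  rw [← ENNReal.ofReal_pow (by positivity), ← ENNReal.ofReal_pow (by positivity),
    ← ENNReal.ofReal_mul ha.le, ← ENNReal.ofReal_mul hb.le, ← ENNReal.ofReal_add (by positivity)
    (by positivity), ← ENNReal.ofReal_one, ← ENNReal.ofReal_add zero_le_one (by positivity)]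
  refine ENNReal.ofReal_le_ofReal ?_
  have hid : p x * (q x / p x) ^ 2 + (1 - p x) * ((1 - q x) / (1 - p x)) ^ 2 =
      1 + (p x - q x) ^ 2 / (p x * (1 - p x)) := by
    field_simp
    ring
  rw [hid, div_eq_mul_inv, mul_comm]
  gcongr
  rw [inv_le_comm₀ (by positivity) (by norm_num)]
  nlinarith [hp0 x, hp1 x]

end BinaryResponse

/-! ### Eigenvectors and powers of the operator -/

section Spectral

variable {H : Type*} [NormedAddCommGroup H] [InnerProductSpace ℝ H]

theorem IsPositiveEigenvalueSequence.finite_setOf_le {B : H →L[ℝ] H} {μ : ℕ+ → ℝ}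
    (hμ : IsPositiveEigenvalueSequence B μ) {t : ℝ} (ht : 0 < t) : {j | t ≤ μ j}.Finite := by
  obtain ⟨N, hN⟩ := (hμ.tendsto_zero.eventually_lt_const ht).exists
  exact (Set.finite_Iic N).subset fun j hj =>
    le_of_not_gt fun h => absurd (hμ.antitone h.le) (not_le.2 (hN.trans_le hj))

/-- Each level set of `μ` is finite, so the multiplicity condition makes the eigenspace
finite-dimensional with an orthonormal basis indexed by that level set. Symmetry makes different
eigenspaces orthogonal. -/
theorem IsPositiveEigenvalueSequence.exists_orthonormal {B : H →L[ℝ] H} {μ : ℕ+ → ℝ}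
    (hμ : IsPositiveEigenvalueSequence B μ) (hB : (B : H →ₗ[ℝ] H).IsSymmetric) :
    ∃ e : ℕ+ → H, Orthonormal ℝ e ∧ ∀ j, B (e j) = μ j • e j := by
  have hbasis (t : Set.Ioi (0 : ℝ)) : ∃ b : {j | μ j = t} →
      Module.End.eigenspace (B : Module.End ℝ H) (t : ℝ), Orthonormal ℝ b := by
    have hfin : {j | μ j = t}.Finite :=
      (hμ.finite_setOf_le t.2).subset fun j hj => (show μ j = t from hj).ge
    have : Fintype {j | μ j = t} := hfin.fintype
    have hmul := hμ.multiplicity t t.2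
    rw [hfin.encard_eq_coe, eq_comm, Cardinal.toENat_eq_natCast] at hmul
    have : Module.Finite ℝ (Module.End.eigenspace (B : Module.End ℝ H) (t : ℝ)) := by
      rw [← Module.rank_lt_aleph0_iff, hmul]
      exact Cardinal.natCast_lt_aleph0
    have hrank : Module.finrank ℝ (Module.End.eigenspace (B : Module.End ℝ H) (t : ℝ)) =
        Fintype.card {j | μ j = t} := by
      rw [Module.finrank, hmul, Cardinal.toNat_natCast]
      exact (Nat.card_coe_set_eq _).symm.trans Nat.card_eq_fintype_card
    exact ⟨_, ((stdOrthonormalBasis ℝ _).reindex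
      ((finCongr hrank).trans (Fintype.equivFin _).symm)).orthonormal⟩
  choose b hb using hbasis
  let e : ℕ+ → H := fun j => (b ⟨μ j, hμ.pos j⟩ ⟨j, rfl⟩ : H)
  -- Transport along `μ j = t`, so that indices with equal eigenvalues are compared within a single
  -- basis.
  have heq (j : ℕ+) (t : ℝ) (ht : 0 < t) (h : μ j = t) : e j = (b ⟨t, ht⟩ ⟨j, h⟩ : H) := by
    subst h; rfl
  refine ⟨e, ⟨fun j => ?_, fun i j hij => ?_⟩, fun j => ?_⟩
  · exact (hb ⟨μ j, hμ.pos j⟩).1 ⟨j, rfl⟩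
  · by_cases h : μ i = μ j
    · simp only
      rw [heq i (μ j) (hμ.pos j) h, heq j (μ j) (hμ.pos j) rfl]
      exact (hb ⟨μ j, hμ.pos j⟩).2 (fun h' => hij (congrArg Subtype.val h'))
    · exact hB.orthogonalFamily_eigenspaces h (b ⟨μ i, hμ.pos i⟩ ⟨i, rfl⟩)
        (b ⟨μ j, hμ.pos j⟩ ⟨j, rfl⟩)
  · exact Module.End.mem_eigenspace_iff.1 (b ⟨μ j, hμ.pos j⟩ ⟨j, rfl⟩).2

variable [CompleteSpace H]

theorem isPowerApply_of_eigenvector {B : H →L[ℝ] H} (hB : (B : H →ₗ[ℝ] H).IsSymmetric) (r : ℝ)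
    {t : ℝ} (ht : 0 < t) {v : H} (hv : B v = t • v) : IsPowerApply B r v (t ^ r • v) := by
  have hmem : v ∈ Module.End.eigenspace (B : Module.End ℝ H) t :=
    Module.End.mem_eigenspace_iff.2 hv
  have h := hasSum_single (f := fun s : Set.Ioi (0 : ℝ) => (s : ℝ) ^ r •
    (Module.End.eigenspace (B : Module.End ℝ H) (s : ℝ)).starProjection v) ⟨t, ht⟩ ?_
  · simpa [IsPowerApply, Submodule.starProjection_eq_self_iff.2 hmem] using h
  · intro s hs
    have hne : (s : ℝ) ≠ t := fun h' => hs (Subtype.ext h')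
    have : v ∈ (Module.End.eigenspace (B : Module.End ℝ H) (s : ℝ))ᗮ := fun w hw =>
      hB.orthogonalFamily_eigenspaces hne ⟨w, hw⟩ ⟨v, hmem⟩
    have h0 : (Module.End.eigenspace (B : Module.End ℝ H) (s : ℝ)).starProjection v = 0 :=
      Submodule.eq_starProjection_of_mem_orthogonal (Submodule.zero_mem _) (by simpa using this)
    rw [h0, smul_zero]

theorem isPowerApply_sum {ι : Type*} {B : H →L[ℝ] H} (hB : (B : H →ₗ[ℝ] H).IsSymmetric) (r : ℝ)
    (s : Finset ι) {l : ι → ℝ} (hl : ∀ i, 0 < l i) {v : ι → H} (hv : ∀ i, B (v i) = l i • v i) :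
    IsPowerApply B r (∑ i ∈ s, v i) (∑ i ∈ s, l i ^ r • v i) := by
  have h := hasSum_sum fun i (_ : i ∈ s) => isPowerApply_of_eigenvector hB r (hl i) (hv i)
  simpa [IsPowerApply, Finset.smul_sum] using h

end Spectral

/-! ### The covariance operator -/

section Covariance

variable {X : Type*} {H : Type*} [NormedAddCommGroup H] [InnerProductSpace ℝ H] [CompleteSpace H]
  [RKHS ℝ H X ℝ]

theorem inner_feature (x : X) (h : H) : inner ℝ (feature H x) h = h x := by
  simp [feature]

theorem abs_apply_le {κ : ℝ} (hκ : ∀ x : X, kern H x x ≤ κ ^ 2) (h : H) (x : X) :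
    |h x| ≤ |κ| * ‖h‖ := by
  have h1 : ‖feature H x‖ ^ 2 ≤ κ ^ 2 := by
    rw [← real_inner_self_eq_norm_sq, inner_feature]
    rw [feature, RKHS.kerFun_apply]
    exact hκ x
  have h2 : ‖feature H x‖ ≤ |κ| := by simpa using sq_le_sq.1 h1
  rw [← inner_feature]
  exact (abs_real_inner_le_norm _ _).trans (by gcongr)

variable [MeasurableSpace X]

/-- Kernel sections are measurable, their span is dense, and norm convergence in `H` implies
pointwise convergence. -/
theorem measurable_coe (hk : Measurable fun p : X × X => kern H p.1 p.2) (h : H) :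
    Measurable (h : X → ℝ) := by
  have hmem : h ∈ closure
      (Submodule.span ℝ {RKHS.kerFun H x v | (x : X) (v : ℝ)} : Set H) := by
    rw [← Submodule.topologicalClosure_coe, RKHS.kerFun_dense]; trivial
  obtain ⟨g, hg, hlim⟩ := mem_closure_iff_seq_limit.1 hmem
  refine measurable_of_tendsto_metrizable (f := fun n => (g n : X → ℝ)) (fun n => ?_)
    (tendsto_pi_nhds.2 fun x => ((RKHS.continuous_eval x).tendsto h).comp hlim)
  have hgn := hg n
  generalize g n = f at hgn ⊢
  induction hgn using Submodule.span_induction with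
  | mem f hf =>
    obtain ⟨y, v, rfl⟩ := hf
    have : (RKHS.kerFun H y v : X → ℝ) = fun x => v * kern H x y := by
      ext x
      rw [RKHS.kerFun_apply, kern, ← smul_eq_mul, ← map_smul, smul_eq_mul, mul_one]
    rw [this]
    exact (hk.comp (measurable_id.prodMk measurable_const)).const_mul v
  | zero => rw [RKHS.coe_zero]; exact measurable_zero
  | add f g _ _ hf hg => simpa using hf.add hg
  | smul a f _ hf => simpa using hf.const_smul a

/-- Otherwise the Bochner integral takes its default value `0`, an operator without positive
eigenvalues. -/
theorem integrable_of_isPositiveEigenvalueSequence {ν : Measure X} {μ : ℕ+ → ℝ}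
    (hμ : IsPositiveEigenvalueSequence (covOp H ν) μ) :
    Integrable (fun x => InnerProductSpace.rankOne ℝ (feature H x) (feature H x)) ν := by
  by_contra h_int
  have hzero : covOp H ν = 0 := integral_undef h_int
  have hmul := hμ.multiplicity (μ 1) (hμ.pos 1)
  have hbot : Module.End.eigenspace (covOp H ν : Module.End ℝ H) (μ 1) = ⊥ := by
    rw [eq_bot_iff]
    intro v hv
    have := Module.End.mem_eigenspace_iff.1 hv
    simpa [hzero, (hμ.pos 1).ne'] using this.symm
  rw [hbot] at hmul
  simp only [rank_bot, map_zero, Set.encard_eq_zero] at hmul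
  exact Set.notMem_empty (1 : ℕ+) (hmul ▸ (rfl : μ 1 = μ 1))

/-- Links the two geometries: eigenvectors orthonormal in `H` are orthogonal in `L²(ν)`, with the
eigenvalues as squared norms. -/
theorem inner_covOp {ν : Measure X}
    (h_int : Integrable (fun x => InnerProductSpace.rankOne ℝ (feature H x) (feature H x)) ν)
    (u v : H) : inner ℝ (covOp H ν u) v = ∫ x, u x * v x ∂ν := by
  have h1 : covOp H ν u = ∫ x, u x • feature H x ∂ν := by
    rw [covOp, ContinuousLinearMap.integral_apply h_int]
    simp [inner_feature]
  have h2 : Integrable (fun x => u x • feature H x) ν := by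
    simpa [inner_feature] using h_int.apply_continuousLinearMap u
  rw [h1, real_inner_comm, ← integral_inner h2]
  exact integral_congr_ae (.of_forall fun x => by
    simp only [inner_smul_right, real_inner_comm (feature H x) v, inner_feature])

theorem isSymmetric_covOp {ν : Measure X}
    (h_int : Integrable (fun x => InnerProductSpace.rankOne ℝ (feature H x) (feature H x)) ν) :
    (covOp H ν : H →ₗ[ℝ] H).IsSymmetric := fun u v => by
  change inner ℝ (covOp H ν u) v = inner ℝ u (covOp H ν v)
  rw [real_inner_comm (covOp H ν v) u, inner_covOp h_int, inner_covOp h_int]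
  simp_rw [mul_comm]

end Covariance

/-! ### The generalized inverse `G⁻¹` -/

section Rates

variable {H : Type*} [NormedAddCommGroup H] [InnerProductSpace ℝ H]
  {B : H →L[ℝ] H} {μ : ℕ+ → ℝ}

theorem encard_Iic_pnat (N : ℕ+) : (Set.Iic N).encard = (N : ℕ) := by
  rw [← Finset.coe_Iic, Set.encard_coe_eq_coe_finsetCard, ← Finset.Icc_bot, PNat.card_Icc]
  simp

theorem IsPositiveEigenvalueSequence.exists_setOf_le_eq_Iic
    (hμ : IsPositiveEigenvalueSequence B μ) {t : ℝ} (ht : 0 < t) (ht1 : t ≤ μ 1) :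
    ∃ N : ℕ+, {j | t ≤ μ j} = Set.Iic N := by
  have hfin := hμ.finite_setOf_le ht
  obtain ⟨N, hN, hmax⟩ := hfin.exists_maximalFor id _ ⟨1, ht1⟩
  refine ⟨N, Set.Subset.antisymm (fun j hj => ?_) fun j hj =>
    (show t ≤ μ N from hN).trans (hμ.antitone hj)⟩
  exact (le_total j N).elim id fun h => hmax hj h

theorem rateG_le_iff {t u r : ℝ} (hu : 0 ≤ u) {N : ℕ+}
    (hN : {j | t ≤ μ j} = Set.Iic N) :
    rateG μ r t ≤ ENNReal.ofReal u ↔ t ^ (2 * r + 1) ≤ u * N := by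
  have hN0 : (0 : ℝ) < (N : ℕ) := by exact_mod_cast N.pos
  have : ((N : ℕ) : ℝ≥0∞) = ENNReal.ofReal (N : ℕ) := by simp
  rw [rateG, countF, hN, encard_Iic_pnat, ENat.toENNReal_coe, this,
    ENNReal.div_le_iff (by simp) (by simp), ← ENNReal.ofReal_mul hu,
    ENNReal.ofReal_le_ofReal_iff (by positivity)]

/-- Beyond `μ 1` the count is `0`, and a positive number over `0` is `∞`. This bounds the set whose
supremum is `G⁻¹(u)`. -/
theorem le_of_rateG_le (hμ : IsPositiveEigenvalueSequence B μ) {t u r : ℝ} (ht : 0 < t)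
    (h : rateG μ r t ≤ ENNReal.ofReal u) : t ≤ μ 1 := by
  by_contra! hlt
  have hempty : {j | t ≤ μ j} = ∅ :=
    Set.eq_empty_of_forall_notMem fun j hj =>
      absurd (hμ.antitone one_le) (not_le.2 (hlt.trans_le hj))
  have h0 : ENNReal.ofReal (t ^ (2 * r + 1)) ≠ 0 := by
    simpa using Real.rpow_pos_of_pos ht (2 * r + 1)
  rw [rateG, countF, hempty, Set.encard_empty, ENat.toENNReal_zero, ENNReal.div_zero h0] at h
  simp at h

/-- The maximum that defines `G⁻¹(u)` is attained, at a point that is at most `μ N` and greater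
than `μ (N + 1)`, where `N = F(G⁻¹(u))`. -/
theorem exists_rateGInv (hμ : IsPositiveEigenvalueSequence B μ) {r u : ℝ} (hr : 0 < r)
    (hu : 0 < u) : 0 < rateGInv μ r u ∧ ∃ N : ℕ+, {j | rateGInv μ r u ≤ μ j} = Set.Iic N ∧
      rateGInv μ r u ^ (2 * r + 1) ≤ u * N := by
  set A : Set ℝ := {t : ℝ | 0 < t ∧ rateG μ r t ≤ ENNReal.ofReal u}
  have hexp : 0 < 2 * r + 1 := by linarith
  have hbdd : BddAbove A := ⟨μ 1, fun t ht => le_of_rateG_le hμ ht.1 ht.2⟩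
  -- Up to `μ 1` the count is at least `1`, so `t ^ (2r+1) ≤ u` suffices for membership.
  have hmem : min (μ 1) (u ^ (2 * r + 1)⁻¹) ∈ A := by
    have hpos : 0 < min (μ 1) (u ^ (2 * r + 1)⁻¹) := lt_min (hμ.pos 1) (by positivity)
    refine ⟨hpos, ?_⟩
    obtain ⟨N, hN⟩ := hμ.exists_setOf_le_eq_Iic hpos (min_le_left _ _)
    rw [rateG_le_iff hu.le hN]
    calc min (μ 1) (u ^ (2 * r + 1)⁻¹) ^ (2 * r + 1)
        ≤ (u ^ (2 * r + 1)⁻¹) ^ (2 * r + 1) := by gcongr; exact min_le_right _ _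
      _ = u * 1 := by rw [Real.rpow_inv_rpow hu.le hexp.ne', mul_one]
      _ ≤ u * N := by gcongr; exact_mod_cast N.pos
  have hval : rateGInv μ r u = sSup A := rfl
  rw [hval]
  have hpos : 0 < sSup A := hmem.1.trans_le (le_csSup hbdd hmem)
  have hle : sSup A ≤ μ 1 := csSup_le ⟨_, hmem⟩ fun t ht => le_of_rateG_le hμ ht.1 ht.2
  obtain ⟨N, hN⟩ := hμ.exists_setOf_le_eq_Iic hpos hle
  refine ⟨hpos, N, hN, ?_⟩
  -- The count equals `N` on `(μ (N + 1), sSup A]`. A point of `A` in this interval and above `(u N)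
  -- ^ (1 / (2r+1))` is contradictory.
  by_contra! hlt
  have hs : (u * N) ^ (2 * r + 1)⁻¹ < sSup A := by
    have := Real.rpow_lt_rpow (by positivity) hlt (inv_pos.2 hexp)
    rwa [Real.rpow_rpow_inv hpos.le hexp.ne'] at this
  have hnext : μ (N + 1) < sSup A := by
    by_contra! h
    have : N + 1 ∈ Set.Iic N := hN ▸ h
    exact absurd this (not_le.2 (PNat.lt_add_right N 1))
  obtain ⟨t, htA, ht⟩ := exists_lt_of_lt_csSup ⟨_, hmem⟩ (max_lt hs hnext)
  have htN : {j | t ≤ μ j} = Set.Iic N := by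
    refine Set.Subset.antisymm (fun j hj => ?_) fun j hj => ?_
    · by_contra! h
      have : μ j ≤ μ (N + 1) := hμ.antitone (PNat.add_one_le_iff.2 (not_le.1 h))
      exact absurd ((le_max_right _ _).trans_lt ht) (not_lt.2 ((show t ≤ μ j from hj).trans this))
    · rw [← hN] at hj
      exact (le_csSup hbdd htA).trans hj
  have h1 := (rateG_le_iff hu.le htN).1 htA.2
  have h2 := Real.rpow_lt_rpow (by positivity) ((le_max_left _ _).trans_lt ht) hexp
  rw [Real.rpow_inv_rpow (by positivity) hexp.ne'] at h2
  linarith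

/-- If `G⁻¹(u) ≥ ε`, then `N` stays below a fixed `K` with `μ K < ε`, and `ε ^ (2r+1) ≤ u K` fails
for small `u`. -/
theorem tendsto_rateGInv (hμ : IsPositiveEigenvalueSequence B μ) {r : ℝ} (hr : 0 < r) :
    Tendsto (rateGInv μ r) (𝓝[>] 0) (𝓝 0) := by
  rw [Metric.tendsto_nhds]
  intro ε hε
  obtain ⟨K, hK⟩ := (hμ.tendsto_zero.eventually_lt_const hε).exists
  have hlim : Tendsto (fun u : ℝ => u * (K : ℝ)) (𝓝[>] 0) (𝓝 0) := by
    have : Tendsto (fun u : ℝ => u * (K : ℝ)) (𝓝 0) (𝓝 (0 * (K : ℝ))) :=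
      (continuous_mul_const _).tendsto 0
    simpa using this.mono_left nhdsWithin_le_nhds
  filter_upwards [hlim.eventually_lt_const (Real.rpow_pos_of_pos hε (2 * r + 1)),
    self_mem_nhdsWithin] with u hu hu0
  have hu0 : 0 < u := hu0
  obtain ⟨hpos, N, hN, hle⟩ := exists_rateGInv hμ hr hu0
  rw [dist_zero_right, Real.norm_of_nonneg hpos.le]
  by_contra! h
  have hNK : N ≤ K := by
    by_contra! hlt
    have h1 : rateGInv μ r u ≤ μ N := by
      have : N ∈ {j | rateGInv μ r u ≤ μ j} := hN ▸ Set.self_mem_Iic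
      exact this
    linarith [hμ.antitone hlt.le]
  have h2 : ε ^ (2 * r + 1) ≤ u * N := (Real.rpow_le_rpow hε.le h (by linarith)).trans hle
  have h3 : u * (N : ℝ) ≤ u * (K : ℝ) := by
    gcongr
    exact_mod_cast hNK
  linarith

end Rates

/-! ### Two-valued responses in the model class -/

section BinaryRegression

variable {X : Type*}
variable {H : Type*} [NormedAddCommGroup H] [InnerProductSpace ℝ H] [CompleteSpace H]
  [RKHS ℝ H X ℝ]

/-- The probability of the response `L` for which the mean of a response `± L` is `f x`. -/
noncomputable def responseProb (L : ℝ) (f : X → ℝ) (x : X) : ℝ := (1 + f x / L) / 2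

theorem responseProb_mem {L : ℝ} (hL : 0 < L) {f : X → ℝ} {x : X} (hf : |f x| ≤ L / 2) :
    1 / 4 ≤ responseProb L f x ∧ responseProb L f x ≤ 3 / 4 := by
  obtain ⟨h1, h2⟩ := abs_le.1 hf
  have h3 : -(1 / 2) ≤ f x / L := by rw [le_div_iff₀ hL]; linarith
  have h4 : f x / L ≤ 1 / 2 := by rw [div_le_iff₀ hL]; linarith
  simp only [responseProb]
  constructor <;> linarith

variable [MeasurableSpace X]

theorem measurable_responseProb (L : ℝ) {f : X → ℝ} (hf : Measurable f) :
    Measurable (responseProb L f) := by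
  unfold responseProb; fun_prop

/-- The noise is bounded by `2 L`, so its `m`-th moment is at most `(2L)² (2L) ^ (m-2)`, and `m! / 2
≥ 1`. -/
theorem inModel_binaryKernel (ν : Measure X) {r M σ R L : ℝ} (hL : 0 < L)
    (hσ : 2 * L ≤ σ) (hM : 2 * L ≤ M) {f : H} (hf : Measurable (f : X → ℝ))
    (hfL : ∀ x, |f x| ≤ L / 2) (hsource : f ∈ sourceSet (covOp H ν) r R) :
    InModel ν r M σ R (ν ⊗ₘ binaryKernel L _ (measurable_responseProb L hf)) f := by
  have h0 (x : X) : 0 ≤ responseProb L f x := by linarith [(responseProb_mem hL (hfL x)).1]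
  have h1 (x : X) : responseProb L f x ≤ 1 := by linarith [(responseProb_mem hL (hfL x)).2]
  refine ⟨hsource, _, isMarkovKernel_binaryKernel L _ h0 h1, rfl, .of_forall fun x => ⟨⟨?_, ?_⟩,
    fun m hm => ⟨?_, ?_⟩⟩⟩
  · exact integrable_binaryKernel L _ _ x
  · rw [integral_binaryKernel L _ h0 h1 (fun y => y)]
    simp only [responseProb]
    field_simp
    ring
  · exact integrable_binaryKernel L _ _ x
  · rw [integral_binaryKernel L _ h0 h1 (fun y => (y - f x) ^ m)]
    obtain ⟨hl, hu⟩ := abs_le.1 (hfL x)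
    have hpow (y : ℝ) (hy : |y| ≤ 2 * L) : y ^ m ≤ σ ^ 2 * M ^ (m - 2) := by
      calc y ^ m ≤ |y| ^ m := by rw [← abs_pow]; exact le_abs_self _
        _ ≤ (2 * L) ^ m := by gcongr
        _ = (2 * L) ^ 2 * (2 * L) ^ (m - 2) := by rw [← pow_add]; congr 1; omega
        _ ≤ σ ^ 2 * M ^ (m - 2) := by gcongr
    have hpos : 0 ≤ σ ^ 2 * M ^ (m - 2) :=
      mul_nonneg (sq_nonneg _) (pow_nonneg (by linarith) _)
    have hfac : (2 : ℝ) ≤ m.factorial := by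
      exact_mod_cast (Nat.factorial_le hm : Nat.factorial 2 ≤ m.factorial)
    calc responseProb L f x * (L - f x) ^ m + (1 - responseProb L f x) * (-L - f x) ^ m
        ≤ responseProb L f x * (σ ^ 2 * M ^ (m - 2)) +
          (1 - responseProb L f x) * (σ ^ 2 * M ^ (m - 2)) := by
          have := h0 x
          have : 0 ≤ 1 - responseProb L f x := by linarith [h1 x]
          gcongr
          · exact hpow _ (abs_le.2 ⟨by linarith, by linarith⟩)
          · exact hpow _ (abs_le.2 ⟨by linarith, by linarith⟩)
      _ = 1 * (σ ^ 2 * M ^ (m - 2)) := by ring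
      _ ≤ (1 / 2 * m.factorial) * (σ ^ 2 * M ^ (m - 2)) := by gcongr; linarith
      _ = _ := by ring

end BinaryRegression

/-! ### The hypercube in the source set -/

section Hypercube

/-- The number `1` or `-1` that encodes a Boolean. -/
def boolSign (b : Bool) : ℝ := if b then 1 else -1

theorem boolSign_sq (b : Bool) : boolSign b ^ 2 = 1 := by cases b <;> simp [boolSign]

/-- A wrongly decoded sign puts `± a` and `y` on opposite sides of `0`. -/
theorem sq_le_of_decide_ne {a y : ℝ} (ha : 0 ≤ a) {b : Bool} (h : decide (0 ≤ y) ≠ b) :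
    a ^ 2 ≤ (boolSign b * a - y) ^ 2 := by
  cases b
  · have : 0 ≤ y := by simpa using h
    simp only [boolSign, Bool.false_eq_true, if_false]
    nlinarith
  · have : y < 0 := by simpa using h
    simp only [boolSign, if_true]
    nlinarith

variable {H : Type*} [NormedAddCommGroup H] [InnerProductSpace ℝ H] {ι : Type*} [Fintype ι]

/-- The vertex `∑ i, ± a e i` of a hypercube with edges along the vectors `e i`. -/
def vertex (a : ℝ) (e : ι → H) (θ : ι → Bool) : H := ∑ i, (boolSign (θ i) * a) • e i

theorem inner_vertex (a : ℝ) {e : ι → H} (he : Orthonormal ℝ e) (θ : ι → Bool) (i : ι) :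
    inner ℝ (e i) (vertex a e θ) = boolSign (θ i) * a := by
  rw [vertex, he.inner_right_fintype]

theorem norm_sum_smul_sq {e : ι → H} (he : Orthonormal ℝ e) (c : ι → ℝ) :
    ‖∑ i, c i • e i‖ ^ 2 = ∑ i, c i ^ 2 := by
  rw [← real_inner_self_eq_norm_sq, he.inner_sum]
  simp [sq]

theorem norm_vertex_sq (a : ℝ) {e : ι → H} (he : Orthonormal ℝ e) (θ : ι → Bool) :
    ‖vertex a e θ‖ ^ 2 = Fintype.card ι * a ^ 2 := by
  rw [vertex, norm_sum_smul_sq he]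
  simp [mul_pow, boolSign_sq]

theorem vertex_sub_vertex_update [DecidableEq ι] (a : ℝ) (e : ι → H) (θ : ι → Bool) (i : ι) :
    vertex a e θ - vertex a e (Function.update θ i (!θ i)) = (boolSign (θ i) * (2 * a)) • e i := by
  rw [vertex, vertex, ← Finset.sum_sub_distrib, Finset.sum_eq_single i]
  · rw [Function.update_self, ← sub_smul]
    congr 1
    cases θ i <;> simp [boolSign] <;> ring
  · intro j _ hj
    rw [Function.update_of_ne hj, sub_self]
  · simp

theorem vertex_mem_sourceSet [CompleteSpace H] {B : H →L[ℝ] H}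
    (hB : (B : H →ₗ[ℝ] H).IsSymmetric) {r R : ℝ} (hR : 0 ≤ R) {a : ℝ} {e : ι → H}
    (he : Orthonormal ℝ e) {l : ι → ℝ} (hl : ∀ i, 0 < l i)
    (hBe : ∀ i, B (e i) = l i • e i) (hsum : ∑ i, (a / l i ^ r) ^ 2 ≤ R ^ 2) (θ : ι → Bool) :
    vertex a e θ ∈ sourceSet B r R := by
  refine ⟨∑ i, (boolSign (θ i) * (a / l i ^ r)) • e i, ?_, ?_⟩
  · refine le_of_sq_le_sq ?_ hR
    rw [norm_sum_smul_sq he]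
    simpa [mul_pow, boolSign_sq] using hsum
  · have h := isPowerApply_sum hB r Finset.univ hl
      (v := fun i => (boolSign (θ i) * (a / l i ^ r)) • e i) fun i => by
        rw [map_smul, hBe, smul_comm]
    convert h using 1
    refine Finset.sum_congr rfl fun i _ => ?_
    have := (Real.rpow_pos_of_pos (hl i) r).ne'
    rw [smul_smul]
    congr 1
    field_simp

end Hypercube

/-! ### Minimax bounds from a hypercube -/

section LowerBound

variable {X : Type*} [MeasurableSpace X]
variable {H : Type*} [NormedAddCommGroup H] [InnerProductSpace ℝ H] [CompleteSpace H]
  [RKHS ℝ H X ℝ]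
variable {ι : Type*} {ν : Measure X}

theorem integral_mul_eq_ite [DecidableEq ι]
    (h_int : Integrable (fun x => InnerProductSpace.rankOne ℝ (feature H x) (feature H x)) ν)
    {e : ι → H} (he : Orthonormal ℝ e) {l : ι → ℝ}
    (hBe : ∀ i, covOp H ν (e i) = l i • e i) (i j : ι) :
    ∫ x, e i x * e j x ∂ν = if i = j then l i else 0 := by
  rw [← inner_covOp h_int, hBe, real_inner_smul_left, orthonormal_iff_ite.1 he]
  simp

theorem memLp_two_coe (hk : Measurable fun p : X × X => kern H p.1 p.2)
    (h_int : Integrable (fun x => InnerProductSpace.rankOne ℝ (feature H x) (feature H x)) ν)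
    (h : H) : MemLp (h : X → ℝ) 2 ν := by
  rw [memLp_two_iff_integrable_sq (measurable_coe hk h).aestronglyMeasurable]
  have := (h_int.apply_continuousLinearMap h).const_inner (𝕜 := ℝ) h
  simpa [inner_smul_right, real_inner_comm (feature H _) h, inner_feature, sq] using this

/-- Bessel's inequality in `L²(ν)` for eigenvectors of the covariance operator. -/
theorem sum_sq_integral_mul_div_le (hk : Measurable fun p : X × X => kern H p.1 p.2)
    (h_int : Integrable (fun x => InnerProductSpace.rankOne ℝ (feature H x) (feature H x)) ν)
    {e : ι → H} (he : Orthonormal ℝ e) {l : ι → ℝ} (hl : ∀ i, 0 < l i)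
    (hBe : ∀ i, covOp H ν (e i) = l i • e i) {g : X → ℝ} (hg : MemLp g 2 ν) (s : Finset ι) :
    ∑ i ∈ s, (∫ x, e i x * g x ∂ν) ^ 2 / l i ≤ (eLpNorm g 2 ν).toReal ^ 2 := by
  classical
  have hinner {u v : X → ℝ} (hu : MemLp u 2 ν) (hv : MemLp v 2 ν) :
      inner ℝ (hu.toLp u) (hv.toLp v) = ∫ x, u x * v x ∂ν := by
    rw [L2.inner_def]
    refine integral_congr_ae ?_
    filter_upwards [hu.coeFn_toLp, hv.coeFn_toLp] with x h1 h2
    rw [h1, h2]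
    simp [mul_comm]
  have hmem (i : ι) : MemLp (e i : X → ℝ) 2 ν := memLp_two_coe hk h_int (e i)
  -- The `L²(ν)` norm of `e i` is `√(l i)`.
  let w : ι → Lp ℝ 2 ν := fun i => (√(l i))⁻¹ • (hmem i).toLp (e i)
  have hw : Orthonormal ℝ w := by
    rw [orthonormal_iff_ite]
    intro i j
    simp only [w, real_inner_smul_left, real_inner_smul_right]
    rw [hinner, integral_mul_eq_ite h_int he hBe]
    split_ifs with h
    · subst h
      have := (Real.sqrt_pos.2 (hl i)).ne'
      field_simp
      rw [Real.sq_sqrt (hl i).le]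
    · simp
  have h := hw.sum_inner_products_le (hg.toLp g) (s := s)
  rw [Lp.norm_toLp] at h
  refine le_trans (le_of_eq (Finset.sum_congr rfl fun i _ => ?_)) h
  simp only [w, real_inner_smul_left]
  rw [hinner, Real.norm_eq_abs, sq_abs, mul_pow, inv_pow, Real.sq_sqrt (hl i).le]
  ring

variable [Fintype ι] [IsProbabilityMeasure ν]

open Classical in
/-- Every measurable guess of the vertex of a small hypercube in the source set is wrong in a fixed
proportion of the coordinates. -/
theorem exists_inModel_le_measure_card_ne [Nonempty ι]
    (hk : Measurable fun p : X × X => kern H p.1 p.2)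
    (h_int : Integrable (fun x => InnerProductSpace.rankOne ℝ (feature H x) (feature H x)) ν)
    {r M σ R L a : ℝ} (hL : 0 < L) (hσ : 2 * L ≤ σ) (hM : 2 * L ≤ M) (hR : 0 ≤ R)
    {e : ι → H} (he : Orthonormal ℝ e) {l : ι → ℝ} (hl : ∀ i, 0 < l i)
    (hBe : ∀ i, covOp H ν (e i) = l i • e i) (hsum : ∑ i, (a / l i ^ r) ^ 2 ≤ R ^ 2)
    (hsup : ∀ θ x, |vertex a e θ x| ≤ L / 2) {n : ℕ} (hn : n ≠ 0)
    (hchi : ∀ i, 6 * a ^ 2 * l i / L ^ 2 ≤ (n : ℝ)⁻¹)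
    (T : (Fin n → X × ℝ) → ι → Bool) (hT : ∀ i, Measurable fun z => T z i) :
    ∃ (P : Measure (X × ℝ)) (θ : ι → Bool), InModel ν r M σ R P (vertex a e θ) ∧
      ENNReal.ofReal (1 / 64) ≤ Measure.pi (fun _ : Fin n => P)
        {z | (1 / 64 : ℝ) * Fintype.card ι ≤
          (Finset.univ.filter fun i => T z i ≠ θ i).card} := by
  let p : (ι → Bool) → X → ℝ := fun θ => responseProb L (vertex a e θ : H)
  have hp (θ : ι → Bool) : Measurable (p θ) := measurable_responseProb L (measurable_coe hk _)
  have hp4 (θ : ι → Bool) (x : X) : 1 / 4 ≤ p θ x ∧ p θ x ≤ 3 / 4 :=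
    responseProb_mem hL (hsup θ x)
  have hmk (θ : ι → Bool) : IsMarkovKernel (binaryKernel L (p θ) (hp θ)) :=
    isMarkovKernel_binaryKernel L (hp θ) (fun x => by linarith [(hp4 θ x).1])
      fun x => by linarith [(hp4 θ x).2]
  let P : (ι → Bool) → Measure (X × ℝ) := fun θ => ν ⊗ₘ binaryKernel L (p θ) (hp θ)
  have hPprob (θ : ι → Bool) : IsProbabilityMeasure (P θ) := by
    simp only [P]; infer_instance
  have hedge (θ : ι → Bool) (i : ι) (A : Set (Fin n → X × ℝ)) (hA : MeasurableSet A) :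
      1 / 16 ≤ (Measure.pi fun _ : Fin n => P θ).real A +
        (Measure.pi fun _ : Fin n => P (Function.update θ i (!θ i))).real Aᶜ := by
    set θ' := Function.update θ i (!θ i)
    have hdens : P θ' = (P θ).withDensity (binaryRatio L (p θ) (p θ')) :=
      compProd_binaryKernel_eq_withDensity ν hL (hp θ) (hp θ')
        (fun x => by linarith [(hp4 θ x).1]) fun x => by linarith [(hp4 θ x).2]
    have : IsProbabilityMeasure ((P θ).withDensity (binaryRatio L (p θ) (p θ'))) :=
      hdens ▸ hPprob θ'
    rw [hdens]
    refine le_measureReal_add_of_lintegral_sq_le hn (P θ)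
      (measurable_binaryRatio L (hp θ) (hp θ')) ?_ hA
    refine (lintegral_binaryRatio_sq_le ν hL (hp θ) (hp θ') (fun x => (hp4 θ x).1)
      (fun x => (hp4 θ x).2) (fun x => by linarith [(hp4 θ' x).1])
      fun x => by linarith [(hp4 θ' x).2]).trans ?_
    gcongr
    -- Along an edge `f` changes by `± 2 a e i`, hence the response probability by `± a e i / L`.
    have hdiff (x : X) : 6 * (p θ x - p θ' x) ^ 2 = 6 * a ^ 2 / L ^ 2 * (e i x * e i x) := by
      have h1 : vertex a e θ x - vertex a e θ' x = boolSign (θ i) * (2 * a) * e i x := by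
        have := congrArg (fun f : H => f x) (vertex_sub_vertex_update a e θ i)
        simpa using this
      have h2 : p θ x - p θ' x = (vertex a e θ x - vertex a e θ' x) / (2 * L) := by
        simp only [p, responseProb]
        field_simp
        ring
      rw [h2, h1, div_pow, mul_pow, mul_pow, boolSign_sq]
      field_simp
    have hval : ∫ x, e i x * e i x ∂ν = l i := by
      rw [← inner_covOp h_int, hBe, real_inner_smul_left, real_inner_self_eq_norm_sq, he.1 i]
      simp
    -- A nonzero integral cannot be the default value.
    have hinte : Integrable (fun x => e i x * e i x) ν :=
      .of_integral_ne_zero (by rw [hval]; exact (hl i).ne')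
    simp_rw [hdiff]
    rw [← ofReal_integral_eq_lintegral_ofReal (hinte.const_mul _)
      (.of_forall fun x => by have := mul_self_nonneg (e i x); positivity),
      integral_const_mul, hval]
    have hn' : (0 : ℝ) < n := by positivity
    refine (ENNReal.ofReal_le_ofReal (le_trans (le_of_eq (by ring)) (hchi i))).trans_eq ?_
    rw [ENNReal.ofReal_inv_of_pos hn']
    simp
  obtain ⟨θ, hθ⟩ := exists_le_measureReal_card_ne (fun θ => Measure.pi fun _ : Fin n => P θ)
    hedge T hT
  refine ⟨P θ, θ, inModel_binaryKernel ν hL hσ hM (measurable_coe hk _) (hsup θ)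
    (vertex_mem_sourceSet (isSymmetric_covOp h_int) hR he hl hBe hsum θ), ?_⟩
  have h4 : (1 / 16 : ℝ) / 4 = 1 / 64 := by norm_num
  rw [h4] at hθ
  exact (ENNReal.ofReal_le_ofReal hθ).trans_eq (by simp [measureReal_def])

open Classical in
-- Decode each sign from `⟪e i, est z⟫`; Bessel's inequality adds up the cost `a²` of every wrong
-- one.
theorem minimaxProbH_ge [Nonempty ι] [MeasurableSpace H] [BorelSpace H]
    (hk : Measurable fun p : X × X => kern H p.1 p.2)
    (h_int : Integrable (fun x => InnerProductSpace.rankOne ℝ (feature H x) (feature H x)) ν)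
    {r M σ R L a : ℝ} (ha : 0 ≤ a) (hL : 0 < L) (hσ : 2 * L ≤ σ) (hM : 2 * L ≤ M) (hR : 0 ≤ R)
    {e : ι → H} (he : Orthonormal ℝ e) {l : ι → ℝ} (hl : ∀ i, 0 < l i)
    (hBe : ∀ i, covOp H ν (e i) = l i • e i) (hsum : ∑ i, (a / l i ^ r) ^ 2 ≤ R ^ 2)
    (hsup : ∀ θ x, |vertex a e θ x| ≤ L / 2) {n : ℕ} (hn : n ≠ 0)
    (hchi : ∀ i, 6 * a ^ 2 * l i / L ^ 2 ≤ (n : ℝ)⁻¹) {b : ℝ}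
    (hb : b ^ 2 < 1 / 64 * Fintype.card ι * a ^ 2) :
    ENNReal.ofReal (1 / 64) ≤ minimaxProbH H ν r M σ R n b := by
  refine le_iInf₂ fun est hest => ?_
  obtain ⟨P, θ, hP, hle⟩ := exists_inModel_le_measure_card_ne hk h_int hL hσ hM hR he hl hBe hsum
    hsup hn hchi (fun z i => decide (0 ≤ inner ℝ (e i) (est z))) fun i => by
      have hm : Measurable fun z => inner ℝ (e i) (est z) :=
        (continuous_const.inner continuous_id).measurable.comp hest
      exact measurable_to_bool (by
        simpa [Set.preimage] using measurableSet_le measurable_const hm)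
  refine (hle.trans (measure_mono fun z hz => ?_)).trans
    (le_iSup₂_of_le P (vertex a e θ) (le_iSup_of_le hP le_rfl))
  refine lt_of_pow_lt_pow_left₀ 2 (norm_nonneg _) (hb.trans_le ?_)
  have hz : (1 / 64 : ℝ) * Fintype.card ι ≤
    (Finset.univ.filter fun i => decide (0 ≤ inner ℝ (e i) (est z)) ≠ θ i).card := hz
  have hbessel := he.sum_inner_products_le (vertex a e θ - est z)
    (s := Finset.univ.filter fun i => decide (0 ≤ inner ℝ (e i) (est z)) ≠ θ i)
  refine le_trans ?_ hbessel
  refine (mul_le_mul_of_nonneg_right hz (sq_nonneg a)).trans ?_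
  rw [← nsmul_eq_mul]
  refine Finset.card_nsmul_le_sum _ _ _ fun i hi => ?_
  rw [inner_sub_right, inner_vertex a he, Real.norm_eq_abs, sq_abs]
  exact sq_le_of_decide_ne ha (Finset.mem_filter.1 hi).2

open Classical in
-- Decode each sign from `∫ e i * est z`. A wrong one costs `(l i * a)² / l i ≥ a² l₀`.
theorem minimaxProbL2_ge [Nonempty ι]
    (hk : Measurable fun p : X × X => kern H p.1 p.2)
    (h_int : Integrable (fun x => InnerProductSpace.rankOne ℝ (feature H x) (feature H x)) ν)
    {r M σ R L a : ℝ} (ha : 0 ≤ a) (hL : 0 < L) (hσ : 2 * L ≤ σ) (hM : 2 * L ≤ M) (hR : 0 ≤ R)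
    {e : ι → H} (he : Orthonormal ℝ e) {l : ι → ℝ} (hl : ∀ i, 0 < l i)
    (hBe : ∀ i, covOp H ν (e i) = l i • e i) (hsum : ∑ i, (a / l i ^ r) ^ 2 ≤ R ^ 2)
    (hsup : ∀ θ x, |vertex a e θ x| ≤ L / 2) {n : ℕ} (hn : n ≠ 0)
    (hchi : ∀ i, 6 * a ^ 2 * l i / L ^ 2 ≤ (n : ℝ)⁻¹) {b l₀ : ℝ} (hb0 : 0 ≤ b) (hl₀ : ∀ i, l₀ ≤ l i)
    (hb : b ^ 2 < 1 / 64 * Fintype.card ι * (a ^ 2 * l₀)) :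
    ENNReal.ofReal (1 / 64) ≤ minimaxProbL2 H ν r M σ R n b := by
  refine le_iInf₂ fun est hest => ?_
  -- Where the product is not integrable this is `0`, harmlessly: its value matters only if the
  -- `L²(ν)` error is finite, and then `est z` is in `L²(ν)`.
  let y : (Fin n → X × ℝ) → ι → ℝ := fun z i => ∫ x, e i x * est z x ∂ν
  have hy (i : ι) : Measurable fun z => y z i := by
    have hm : Measurable fun q : (Fin n → X × ℝ) × X => e i q.2 * est q.1 q.2 :=
      ((measurable_coe hk (e i)).comp measurable_snd).mul hest
    exact (hm.stronglyMeasurable.integral_prod_right' (ν := ν)).measurable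
  obtain ⟨P, θ, hP, hle⟩ := exists_inModel_le_measure_card_ne hk h_int hL hσ hM hR he hl hBe hsum
    hsup hn hchi (fun z i => decide (0 ≤ y z i)) fun i =>
      measurable_to_bool (by simpa [Set.preimage] using measurableSet_le measurable_const (hy i))
  refine (hle.trans (measure_mono fun z hz => ?_)).trans
    (le_iSup₂_of_le P (vertex a e θ) (le_iSup_of_le hP le_rfl))
  have hz : (1 / 64 : ℝ) * Fintype.card ι ≤
    (Finset.univ.filter fun i => decide (0 ≤ y z i) ≠ θ i).card := hz
  have hgm : Measurable fun x => vertex a e θ x - est z x :=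
    (measurable_coe hk _).sub (hest.comp (measurable_const.prodMk measurable_id))
  change ENNReal.ofReal b < eLpNorm (fun x => vertex a e θ x - est z x) 2 ν
  by_cases htop : eLpNorm (fun x => vertex a e θ x - est z x) 2 ν = ⊤
  · rw [htop]; exact ENNReal.ofReal_lt_top
  have hg : MemLp (fun x => vertex a e θ x - est z x) 2 ν :=
    ⟨hgm.aestronglyMeasurable, lt_top_iff_ne_top.2 htop⟩
  have hbessel := sum_sq_integral_mul_div_le hk h_int he hl hBe hg
    (Finset.univ.filter fun i => decide (0 ≤ y z i) ≠ θ i)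
  rw [ENNReal.ofReal_lt_iff_lt_toReal hb0 htop]
  refine lt_of_pow_lt_pow_left₀ 2 ENNReal.toReal_nonneg (hb.trans_le (le_trans ?_ hbessel))
  have hal : 0 ≤ a ^ 2 * l₀ := by
    by_contra! h
    have : (0 : ℝ) ≤ 1 / 64 * Fintype.card ι := by positivity
    nlinarith [sq_nonneg b]
  refine (mul_le_mul_of_nonneg_right hz hal).trans ?_
  rw [← nsmul_eq_mul]
  refine Finset.card_nsmul_le_sum _ _ _ fun i hi => ?_
  have hmem (h : H) : MemLp (h : X → ℝ) 2 ν := memLp_two_coe hk h_int h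
  have hval : ∫ x, e i x * (vertex a e θ x - est z x) ∂ν =
      boolSign (θ i) * (l i * a) - y z i := by
    have hest2 : MemLp (est z) 2 ν := by
      have := (hmem (vertex a e θ)).sub hg
      have hfun : ((vertex a e θ : H) : X → ℝ) - (fun x => vertex a e θ x - est z x) = est z := by
        ext x; simp
      rwa [hfun] at this
    have h1 : Integrable (fun x => e i x * vertex a e θ x) ν := (hmem (e i)).integrable_mul (hmem _)
    have h2 : Integrable (fun x => e i x * est z x) ν := (hmem (e i)).integrable_mul hest2
    simp_rw [mul_sub]
    rw [integral_sub h1 h2,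
      ← inner_covOp h_int, hBe, real_inner_smul_left, inner_vertex a he]
    ring
  rw [hval, le_div_iff₀ (hl i)]
  calc a ^ 2 * l₀ * l i ≤ a ^ 2 * l i * l i := by
        have := hl i
        gcongr
        exact hl₀ i
    _ = (l i * a) ^ 2 := by ring
    _ ≤ _ := sq_le_of_decide_ne (mul_nonneg (hl i).le ha) (Finset.mem_filter.1 hi).2

end LowerBound

/-! ### Choice of the hypercube and of the constants -/

/-- A proportion `N / 64` of wrong coordinates in the hypercube spanned by the eigenvectors with
indices `N + 1, …, 2 N`, where `N = F(G⁻¹(u))`, gives the rate for both norms. -/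
theorem minimaxProb_ge_of_doubling {X : Type*} [MeasurableSpace X] {ν : Measure X}
    [IsProbabilityMeasure ν]
    {H : Type*} [NormedAddCommGroup H] [InnerProductSpace ℝ H] [CompleteSpace H]
    [MeasurableSpace H] [BorelSpace H] [RKHS ℝ H X ℝ]
    (hk : Measurable fun p : X × X => kern H p.1 p.2)
    {κ : ℝ} (hκ : ∀ x : X, kern H x x ≤ κ ^ 2) {μ : ℕ+ → ℝ}
    (hμ : IsPositiveEigenvalueSequence (covOp H ν) μ)
    {r M σ R : ℝ} (hσ : 0 < σ) (hR : 0 < R) {d q : ℝ} (hd : 0 < d) (hd1 : d ≤ 1)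
    (hdM : d * σ ≤ M) (hq : 0 < q) (hq1 : q ≤ 1) {n : ℕ} (hn : n ≠ 0) {t : ℝ} (ht : 0 < t)
    {N : ℕ+} (hN : {j | t ≤ μ j} = Set.Iic N)
    (htN : t ^ (2 * r + 1) ≤ σ ^ 2 / (R ^ 2 * n) * N) (hdoubling : q ≤ μ (2 * N) / μ N)
    {c₁ τ : ℝ} (hc₁ : 0 < c₁) (hc₁q : c₁ ≤ (q ^ r) ^ 2) (hc₁d : 24 * c₁ ≤ d ^ 2)
    (hτ : 0 < τ) (hτc : τ ^ 2 < 1 / 64 * (c₁ * q))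
    (hsmall : |κ| * (√c₁ * R * t ^ r) ≤ d * σ / 4) (hr : 0 ≤ r) :
    ENNReal.ofReal (1 / 64) ≤ minimaxProbH H ν r M σ R n (τ * (R * t ^ r)) ∧
    ENNReal.ofReal (1 / 64) ≤ minimaxProbL2 H ν r M σ R n (τ * (R * t ^ (r + 1 / 2))) := by
  have h_int := integrable_of_isPositiveEigenvalueSequence hμ
  obtain ⟨e₀, he₀, hBe₀⟩ := hμ.exists_orthonormal (isSymmetric_covOp h_int)
  -- `succPNat` adds one, so the indices run from `N + 1` to `2 N`.
  let idx : Fin N → ℕ+ := fun i => N + (i : ℕ).succPNat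
  have hidx : Function.Injective idx := fun i j hij =>
    Fin.ext (Nat.succPNat_injective (add_left_cancel hij))
  have : Nonempty (Fin N) := ⟨⟨0, N.pos⟩⟩
  have hN0 : (0 : ℝ) < N := by exact_mod_cast N.pos
  have hn0 : (0 : ℝ) < n := by exact_mod_cast Nat.pos_of_ne_zero hn
  have htr : 0 < t ^ r := Real.rpow_pos_of_pos ht r
  have hqr : 0 < q ^ r := Real.rpow_pos_of_pos hq r
  have hpow : t ^ (2 * r + 1) = (t ^ r) ^ 2 * t := by
    rw [Real.rpow_add ht, Real.rpow_one, ← Real.rpow_natCast, ← Real.rpow_mul ht.le]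
    congr 2
    push_cast
    ring
  have hpow' : (t ^ (r + 1 / 2)) ^ 2 = (t ^ r) ^ 2 * t := by
    rw [← hpow, ← Real.rpow_natCast, ← Real.rpow_mul ht.le]
    congr 1
    push_cast
    ring
  have hlower (i : Fin N) : q * t ≤ μ (idx i) := by
    have h1 : t ≤ μ N := by
      have : N ∈ {j | t ≤ μ j} := hN ▸ Set.self_mem_Iic
      exact this
    have h2 : idx i ≤ 2 * N := by
      rw [← PNat.coe_le_coe]
      simp only [idx, PNat.add_coe, PNat.mul_coe, Nat.succPNat_coe]
      have := i.2
      change (N : ℕ) + ((i : ℕ) + 1) ≤ 2 * (N : ℕ)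
      omega
    rw [le_div_iff₀ (hμ.pos N)] at hdoubling
    exact (mul_le_mul_of_nonneg_left h1 hq.le).trans (hdoubling.trans (hμ.antitone h2))
  have hupper (i : Fin N) : μ (idx i) ≤ t := by
    by_contra! h
    have : idx i ∈ Set.Iic N := hN ▸ h.le
    exact absurd this (not_le.2 (PNat.lt_add_right N _))
  set a : ℝ := √c₁ * R * t ^ r / √N with ha
  have ha0 : 0 ≤ a := by positivity
  have ha2 : (N : ℝ) * a ^ 2 = c₁ * R ^ 2 * (t ^ r) ^ 2 := by
    rw [ha, div_pow, mul_pow, mul_pow, Real.sq_sqrt hc₁.le, Real.sq_sqrt hN0.le]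
    field_simp
  have he : Orthonormal ℝ (e₀ ∘ idx) := he₀.comp idx hidx
  have hl (i : Fin N) : 0 < μ (idx i) := hμ.pos _
  have hBe (i : Fin N) : covOp H ν ((e₀ ∘ idx) i) = μ (idx i) • (e₀ ∘ idx) i := hBe₀ _
  have hsum : ∑ i, (a / μ (idx i) ^ r) ^ 2 ≤ R ^ 2 := by
    calc ∑ i, (a / μ (idx i) ^ r) ^ 2 ≤ ∑ _i : Fin N, (a / (q * t) ^ r) ^ 2 := by
          refine Finset.sum_le_sum fun i _ => ?_
          have := Real.rpow_pos_of_pos (mul_pos hq ht) r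
          have := Real.rpow_pos_of_pos (hl i) r
          gcongr
          exact hlower i
      _ = c₁ / (q ^ r) ^ 2 * R ^ 2 := by
          rw [Finset.sum_const, Finset.card_univ, Fintype.card_fin, nsmul_eq_mul, div_pow,
            ← mul_div_assoc, ha2, Real.mul_rpow hq.le ht.le]
          field_simp
      _ ≤ 1 * R ^ 2 := by
          gcongr
          rw [div_le_one (by positivity)]
          exact hc₁q
      _ = R ^ 2 := one_mul _
  have hsup (θ : Fin N → Bool) (x : X) : |vertex a (e₀ ∘ idx) θ x| ≤ d * σ / 2 / 2 := by
    have hnorm : ‖vertex a (e₀ ∘ idx) θ‖ = √c₁ * R * t ^ r := by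
      refine (sq_eq_sq₀ (norm_nonneg _) (by positivity)).1 ?_
      rw [norm_vertex_sq a he, Fintype.card_fin, ha2, mul_pow, mul_pow, Real.sq_sqrt hc₁.le]
    refine (abs_apply_le hκ _ x).trans ?_
    rw [hnorm]
    linarith
  -- The inequality `t ^ (2r+1) ≤ u N` enters here; `24 = 6 · 4` because `L = d σ / 2`.
  have hchi (i : Fin N) : 6 * a ^ 2 * μ (idx i) / (d * σ / 2) ^ 2 ≤ (n : ℝ)⁻¹ := by
    have h1 : a ^ 2 * t ≤ c₁ * σ ^ 2 / n := by
      have h2 : (N : ℝ) * (a ^ 2 * t) ≤ N * (c₁ * σ ^ 2 / n) := by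
        calc (N : ℝ) * (a ^ 2 * t) = c₁ * R ^ 2 * t ^ (2 * r + 1) := by
              rw [hpow, ← mul_assoc, ha2]; ring
          _ ≤ c₁ * R ^ 2 * (σ ^ 2 / (R ^ 2 * n) * N) := by gcongr
          _ = N * (c₁ * σ ^ 2 / n) := by field_simp
      exact le_of_mul_le_mul_left h2 hN0
    rw [div_le_iff₀ (by positivity)]
    calc 6 * a ^ 2 * μ (idx i) ≤ 6 * (a ^ 2 * t) := by
          rw [mul_assoc]; gcongr; exact hupper i
      _ ≤ 6 * (c₁ * σ ^ 2 / n) := by gcongr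
      _ = 24 * c₁ * (σ ^ 2 / n / 4) := by ring
      _ ≤ d ^ 2 * (σ ^ 2 / n / 4) := by gcongr
      _ = (n : ℝ)⁻¹ * (d * σ / 2) ^ 2 := by ring
  have hL : 0 < d * σ / 2 := by positivity
  have hLσ : 2 * (d * σ / 2) ≤ σ := by nlinarith
  have hLM : 2 * (d * σ / 2) ≤ M := by linarith
  have hrate (s : ℝ) (hs : 0 < s) : (τ * R) ^ 2 * s < 1 / 64 * (c₁ * q) * (R ^ 2 * s) := by
    rw [mul_pow, mul_assoc]
    gcongr
  constructor
  · refine minimaxProbH_ge hk h_int ha0 hL hLσ hLM hR.le he hl hBe hsum hsup hn hchi ?_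
    rw [Fintype.card_fin]
    calc (τ * (R * t ^ r)) ^ 2 = (τ * R) ^ 2 * (t ^ r) ^ 2 := by ring
      _ < 1 / 64 * (c₁ * q) * (R ^ 2 * (t ^ r) ^ 2) := hrate _ (by positivity)
      _ ≤ 1 / 64 * (c₁ * 1) * (R ^ 2 * (t ^ r) ^ 2) := by gcongr
      _ = 1 / 64 * (c₁ * R ^ 2 * (t ^ r) ^ 2) := by ring
      _ = 1 / 64 * N * a ^ 2 := by rw [← ha2]; ring
  · refine minimaxProbL2_ge hk h_int ha0 hL hLσ hLM hR.le he hl hBe hsum hsup hn hchi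
      (by positivity) hlower ?_
    rw [Fintype.card_fin]
    calc (τ * (R * t ^ (r + 1 / 2))) ^ 2 = (τ * R) ^ 2 * ((t ^ r) ^ 2 * t) := by
          rw [← hpow']; ring
      _ < 1 / 64 * (c₁ * q) * (R ^ 2 * ((t ^ r) ^ 2 * t)) := hrate _ (by positivity)
      _ = 1 / 64 * (c₁ * R ^ 2 * (t ^ r) ^ 2) * (q * t) := by ring
      _ = 1 / 64 * N * (a ^ 2 * (q * t)) := by rw [← ha2]; ring

end KernelRegression

theorem theorem3p1 (r : ℝ) (hr : 0 < r) (νs : ℝ) (hνs : 1 ≤ νs) (c : ℝ) (hc : 0 < c) :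
    ∃ τ : ℝ, 0 < τ ∧
      ∀ (X : Type*) [MeasurableSpace X] [StandardBorelSpace X]
        (ν : Measure X) [IsProbabilityMeasure ν]
        (H : Type*) [NormedAddCommGroup H] [InnerProductSpace ℝ H] [CompleteSpace H]
        [TopologicalSpace.SeparableSpace H] [MeasurableSpace H] [BorelSpace H]
        [RKHS ℝ H X ℝ]
        (_ : Measurable (fun p : X × X => KernelRegression.kern H p.1 p.2))
        (κ : ℝ) (_ : ∀ x : X, KernelRegression.kern H x x ≤ κ ^ 2)
        (μ : ℕ+ → ℝ)
        (_ : KernelRegression.IsPositiveEigenvalueSequence (KernelRegression.covOp H ν) μ)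
        (_ : ∀ᶠ j : ℕ+ in atTop, (2 : ℝ) ^ (-νs) ≤ μ (2 * j) / μ j)
        (M σ R : ℝ) (_ : 0 < M) (_ : 0 < σ) (_ : 0 < R) (_ : c * σ ≤ M),
        0 < liminf (fun n : ℕ => KernelRegression.minimaxProbH H ν r M σ R n
            (τ * KernelRegression.rate μ r 0 σ R n)) atTop ∧
        0 < liminf (fun n : ℕ => KernelRegression.minimaxProbL2 H ν r M σ R n
            (τ * KernelRegression.rate μ r (1 / 2) σ R n)) atTop := by
  set q : ℝ := (2 : ℝ) ^ (-νs)
  have hq : 0 < q := by positivity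
  have hq1 : q ≤ 1 := Real.rpow_le_one_of_one_le_of_nonpos one_le_two (by linarith)
  -- Ensures `d σ ≤ σ` and `d σ ≤ M`, that is, `2 L ≤ min σ M`.
  set d : ℝ := min 1 c
  have hd : 0 < d := lt_min one_pos hc
  have hqr : 0 < q ^ r := Real.rpow_pos_of_pos hq r
  -- The first bound gives the source condition, the second the `χ²` condition.
  set c₁ : ℝ := min ((q ^ r) ^ 2) (d ^ 2 / 24)
  have hc₁ : 0 < c₁ := lt_min (by positivity) (by positivity)
  have hτ2 : √(c₁ * q / 128) ^ 2 = c₁ * q / 128 := Real.sq_sqrt (by positivity)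
  -- Half of `c₁ q / 64`, for strict inequality.
  refine ⟨√(c₁ * q / 128), by positivity, ?_⟩
  intro X _ _ ν _ H _ _ _ _ _ _ _ hk κ hκ μ hμ hdoubling M σ R _ hσ hR hcM
  have hu : Tendsto (fun n : ℕ => σ ^ 2 / (R ^ 2 * n)) atTop (𝓝[>] 0) := by
    refine tendsto_nhdsWithin_iff.2 ⟨?_, ?_⟩
    · exact tendsto_const_nhds.div_atTop
        (tendsto_natCast_atTop_atTop.const_mul_atTop (by positivity))
    · filter_upwards [eventually_ne_atTop 0] with n hn
      have : (0 : ℝ) < n := by exact_mod_cast Nat.pos_of_ne_zero hn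
      exact Set.mem_Ioi.2 (by positivity)
  have ht := (KernelRegression.tendsto_rateGInv hμ hr).comp hu
  obtain ⟨j₀, hj₀⟩ := eventually_atTop.1 hdoubling
  -- `κ` enters only through this sup-norm bound, so it affects how large `n` must be but not `τ`.
  have hsmall : Tendsto (fun n : ℕ => |κ| * (√c₁ * R *
      KernelRegression.rateGInv μ r (σ ^ 2 / (R ^ 2 * n)) ^ r)) atTop (𝓝 0) := by
    have h := ((ht.rpow_const (p := r) (.inr hr.le)).const_mul (√c₁ * R)).const_mul |κ|
    simpa [Real.zero_rpow hr.ne'] using h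
  have hmain : ∀ᶠ n : ℕ in atTop,
      ENNReal.ofReal (1 / 64) ≤ KernelRegression.minimaxProbH H ν r M σ R n
        (√(c₁ * q / 128) * KernelRegression.rate μ r 0 σ R n) ∧
      ENNReal.ofReal (1 / 64) ≤ KernelRegression.minimaxProbL2 H ν r M σ R n
        (√(c₁ * q / 128) * KernelRegression.rate μ r (1 / 2) σ R n) := by
    filter_upwards [eventually_ne_atTop 0, hu.eventually self_mem_nhdsWithin,
      ht.eventually_lt_const (hμ.pos j₀),
      hsmall.eventually_lt_const (show 0 < d * σ / 4 by positivity)] with n hn hun htn hsn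
    obtain ⟨htpos, N, hN, htN⟩ := KernelRegression.exists_rateGInv hμ hr (Set.mem_Ioi.1 hun)
    -- `t < μ j₀` forces `j₀ ≤ N`, so the eventual doubling condition applies at `N`.
    have hjN : j₀ ∈ Set.Iic N := hN ▸ htn.le
    simp only [KernelRegression.rate, add_zero]
    exact KernelRegression.minimaxProb_ge_of_doubling hk hκ hμ hσ hR hd (min_le_left _ _)
      ((mul_le_mul_of_nonneg_right (min_le_right _ _) hσ.le).trans hcM) hq hq1 hn htpos hN htN
      (hj₀ N hjN) hc₁ (min_le_left _ _) (by linarith [min_le_right ((q ^ r) ^ 2) (d ^ 2 / 24)])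
      (by positivity) (by rw [hτ2]; linarith [mul_pos hc₁ hq]) hsn.le hr.le
  have h64 : (0 : ℝ≥0∞) < ENNReal.ofReal (1 / 64) := by simp
  exact ⟨h64.trans_le (le_liminf_of_le (by isBoundedDefault) (hmain.mono fun _ h => h.1)),
    h64.trans_le (le_liminf_of_le (by isBoundedDefault) (hmain.mono fun _ h => h.2))⟩
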